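/- **Setting.** A network consists of $n\ge 1$ nodes and a directed graph $\mathrm G$ on $\mathrm V=\{1,\dots,n\}$ (self-arcs allowed) with real arc weights, $a_{ij}\neq 0$ if and only if there is an arc from $j$ to $i$. Write $\mathrm N_i=\{j: a_{ij}\ne 0\}$, $A_{\mathrm G}=(a_{ij})$ and $\|A_{\mathrm G}\|_\infty=\max_i\sum_{j\in \mathrm N_i}|a_{ij}|$. The states satisfy, for $t=0,1,2,\dots$, $$\mathbf x_i(t+1)=\sum_{j\in \mathrm N_i}a_{ij}f(\mathbf x_j(t))+\mathbf u_i(t)+\mathbf w_i(t),\qquad i=1,\dots,n,$$ where $f:\mathbb R\to\mathbb R$ is unknown, the disturbances satisfy $|\mathbf w_i(t)|\le w_*$ for all $i,t$ with an unknown $w_*>0$, and there are estimates $\mathbf z_i(t)$ with $|f(\mathbf x_i(t))-\mathbf z_i(t)|\le D_0$ for all $i,t$ with an unknown $D_0$; $\mathbf z_i(t)$ is available from time $t+1$ on. Let $\Theta(t)$ collect $\mathbf x_i(0),\dots,\mathbf x_i(t)$; $\mathbf z_i(0),\dots,\mathbf z_i(t-1)$; $\mathbf u_i(0),\dots,\mathbf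 u_i(t-1)$ for all nodes $i$. A *network-flow/local-decision feedback law* prescribes, for every number of nodes $n$, every node $i$ and every time $t$, an arbitrary function $h^i_t$, by which $$\mathbf u_i(t)=h^i_t\big(\Theta(t);\,a_{ij},\ j\in \mathrm N_i\big).$$ It *stabilizes* the network for $(\mathrm G,f)$ if $\sup_{t\ge0}\big(|\mathbf x_i(t)|+|\mathbf u_i(t)|\big)<\infty$ for all $i\in\mathrm V$, for all initial states, all disturbances and all estimates as above. For $L>0$ let $\mathcal F_L$ be the set of all $f:\mathbb R\to\mathbb R$ with $$\lim_{\alpha\to\infty}\ \sup_{x,y\in\mathbb R}\frac{|f(x)-f(y)|}{|x-y|+\alpha}\le L.$$ **Theorem.** Let $L>0$ (and read $(3/2+\sqrt2)/0$ as $+\infty$). There exists a generic network-flow/local-decision feedback law that stabilizes the network dynamics for all $f\in\mathcal F_L$ if and only if $L<(3/2+\sqrt2)/\|A_{\mathrm G}\|_\infty$. Precisely: 1. There is one network-flow/local-decision feedback law that stabilizes the network for all graphs $\mathrm G$ (with any number of nodes) with $L<(3/2+\sqrt2)/\|A_{\mathrm G}\|_\infty$ and all $f\in\mathcal F_L$.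 2. For every $\alpha\ge 0$: a network-flow/local-decision feedback law that stabilizes the network for all graphs $\mathrm G$ with $\|A_{\mathrm G}\|_\infty=\alpha$ and all $f\in\mathcal F_L$ exists if and only if $L<(3/2+\sqrt2)/\alpha$. 3. For every $\alpha>0$ with $L\ge(3/2+\sqrt2)/\alpha$ and every network-flow/local-decision feedback law there is a graph $\mathrm G$ with $\|A_{\mathrm G}\|_\infty=\alpha$ such that for every initial state $\mathbf X(0)$ there are an $f\in\mathcal F_L$ and admissible disturbances and estimates for which the closed loop satisfies $\limsup_{t\to\infty}\max_{i}|\mathbf x_i(t)|=\infty$. -/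

import Mathlib

open Filter Topology
open scoped ENNReal

noncomputable section

namespace NetworkFeedback

/-- A weighted directed graph on the node set `Fin n`; self-arcs are allowed.
`arc j i` says that there is an arc from `j` to `i`, and `weight i j` is the weight of that arc,
so that `weight` is the adjacency matrix of the graph. -/
structure InteractionGraph (n : ℕ) where
  arc : Fin n → Fin n → Prop
  weight : Matrix (Fin n) (Fin n) ℝ
  weight_ne_zero_iff : ∀ i j, weight i j ≠ 0 ↔ arc j i

namespace InteractionGraph

variable {n : ℕ}

open Classical in
/-- The neighbors of node `i`: the nodes that influence `i`. -/
def neighbors (G : InteractionGraph n) (i : Fin n) : Finset (Fin n) :=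
  Finset.univ.filter (fun j => G.arc j i)

/-- The infinity norm of the adjacency matrix: the largest absolute row sum. -/
def infNorm (G : InteractionGraph n) : ℝ :=
  ⨆ i : Fin n, ∑ j ∈ G.neighbors i, |G.weight i j|

/-- What node `i` knows about the graph: the weights of its own incoming arcs
(extended by zero to the nodes that are not neighbors of `i`). -/
def localWeights (G : InteractionGraph n) (i : Fin n) : Fin n → ℝ :=
  fun j => G.weight i j

end InteractionGraph

/-- The supremum of `|f x - f y| / (|x - y| + a)` over all real `x` and `y`
(possibly infinite). -/
def slopeSup (f : ℝ → ℝ) (a : ℝ) : ℝ≥0∞ :=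
  ⨆ x : ℝ, ⨆ y : ℝ, ENNReal.ofReal (|f x - f y| / (|x - y| + a))

/-- The quasi-norm of `f`: the limit of `slopeSup f a` as `a` tends to infinity
(possibly infinite). -/
def quasiNorm (f : ℝ → ℝ) : ℝ≥0∞ :=
  limUnder atTop (slopeSup f)

/-- The limit that defines the quasi-norm exists for every function. -/
theorem tendsto_slopeSup (f : ℝ → ℝ) :
    Tendsto (slopeSup f) atTop (𝓝 (quasiNorm f)) := by
  have hanti : Antitone (fun a : ℝ => slopeSup f (max a 1)) := by
    intro a b hab
    refine iSup_mono fun x => iSup_mono fun y => ENNReal.ofReal_le_ofReal ?_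
    have h1 : (1 : ℝ) ≤ max a 1 := le_max_right _ _
    have h2 : max a 1 ≤ max b 1 := max_le_max_right 1 hab
    have h3 : 0 ≤ |x - y| := abs_nonneg _
    exact div_le_div_of_nonneg_left (abs_nonneg _) (by linarith) (by linarith)
  have h := tendsto_atTop_iInf hanti
  have hev : (fun a : ℝ => slopeSup f (max a 1)) =ᶠ[atTop] slopeSup f := by
    filter_upwards [eventually_ge_atTop (1 : ℝ)] with a ha
    rw [max_eq_left ha]
  exact tendsto_nhds_limUnder ⟨_, h.congr' hev⟩

/-- The class of all functions whose quasi-norm is at most `L`. -/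
def functionClass (L : ℝ) : Set (ℝ → ℝ) :=
  {f | quasiNorm f ≤ ENNReal.ofReal L}

/-- The network flow up to time `t`: the states `X 0, …, X t`, the estimates `Z 0, …, Z (t-1)`
and the inputs `U 0, …, U (t-1)` of all nodes. -/
structure NetworkFlow (n t : ℕ) where
  X : Fin (t + 1) → Fin n → ℝ
  Z : Fin t → Fin n → ℝ
  U : Fin t → Fin n → ℝ

/-- The network flow up to time `t` recorded along sequences of states, estimates and inputs. -/
def flowUpTo {n : ℕ} (x z u : ℕ → Fin n → ℝ) (t : ℕ) : NetworkFlow n t where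
  X s := x s
  Z s := z s
  U s := u s

/-- A network-flow/local-decision feedback law: for every number of nodes `n`, every node `i` and
every time `t`, an arbitrary function of the network flow up to time `t` and of the weights of the
arcs that enter node `i`, whose value is the input at node `i`. -/
def LocalDecisionLaw : Type :=
  (n : ℕ) → (i : Fin n) → (t : ℕ) → NetworkFlow n t → (Fin n → ℝ) → ℝ

/-- The closed loop of the network dynamics on `G` with node dynamics `f` under the law `h`:
`x` are the states, `u` the inputs, `w` the (bounded) disturbances and `z` the estimates of
`f (x t i)`, whose errors are bounded. -/
structure IsClosedLoop (h : LocalDecisionLaw) {n : ℕ} (G : InteractionGraph n) (f : ℝ → ℝ)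
    (w z x u : ℕ → Fin n → ℝ) : Prop where
  disturbance_bounded : ∃ wstar : ℝ, 0 < wstar ∧ ∀ t i, |w t i| ≤ wstar
  estimate_bounded : ∃ D₀ : ℝ, ∀ t i, |f (x t i) - z t i| ≤ D₀
  control : ∀ t i, u t i = h n i t (flowUpTo x z u t) (G.localWeights i)
  dynamics : ∀ t i,
    x (t + 1) i = ∑ j ∈ G.neighbors i, G.weight i j * f (x t j) + u t i + w t i

/-- The law `h` stabilizes the network dynamics on `G` with node dynamics `f`: along every closed
loop (whatever the initial states, the disturbances and the estimates), the states and the inputs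
of every node stay bounded. -/
def Stabilizes (h : LocalDecisionLaw) {n : ℕ} (G : InteractionGraph n) (f : ℝ → ℝ) : Prop :=
  ∀ w z x u : ℕ → Fin n → ℝ, IsClosedLoop h G f w z x u →
    ∀ i, BddAbove (Set.range fun t => |x t i| + |u t i|)

end NetworkFeedback

end

namespace NetworkFeedback

/-! ### The function class -/

theorem mem_functionClass_of_lipschitz {f : ℝ → ℝ} {L : ℝ} (hL : 0 ≤ L)
    (hf : ∀ x y, |f x - f y| ≤ L * |x - y|) : f ∈ functionClass L := by
  refine le_of_tendsto (tendsto_slopeSup f) ?_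
  filter_upwards [eventually_gt_atTop (0 : ℝ)] with a ha
  refine iSup₂_le fun x y => ENNReal.ofReal_le_ofReal ?_
  have h : 0 < |x - y| + a := by positivity
  rw [div_le_iff₀ h]
  nlinarith [hf x y, mul_nonneg hL ha.le]

theorem exists_affine_bound_of_mem_functionClass {f : ℝ → ℝ} {L K : ℝ} (hL : 0 < L)
    (hf : f ∈ functionClass L) (hK : L < K) : ∃ C, ∀ x y, |f x - f y| ≤ K * |x - y| + C := by
  have hlt : quasiNorm f < ENNReal.ofReal K :=
    lt_of_le_of_lt hf ((ENNReal.ofReal_lt_ofReal_iff (hL.trans hK)).2 hK)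
  obtain ⟨a, ha, ha0⟩ :=
    (((tendsto_slopeSup f).eventually (gt_mem_nhds hlt)).and (eventually_gt_atTop (0 : ℝ))).exists
  refine ⟨K * a, fun x y => ?_⟩
  have h1 : ENNReal.ofReal (|f x - f y| / (|x - y| + a)) ≤ ENNReal.ofReal K :=
    (le_iSup₂ (f := fun x y : ℝ => ENNReal.ofReal (|f x - f y| / (|x - y| + a))) x y).trans ha.le
  have h2 := (ENNReal.ofReal_le_ofReal_iff (hL.trans hK).le).1 h1
  have h : 0 < |x - y| + a := by positivity
  rw [div_le_iff₀ h] at h2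
  linarith

/-! ### The graph -/

namespace InteractionGraph

variable {n : ℕ}

theorem sum_neighbors (G : InteractionGraph n) (i : Fin n) (c : Fin n → ℝ) (φ : ℝ → ℝ)
    (hφ : φ 0 = 0) :
    ∑ j ∈ G.neighbors i, φ (G.weight i j) * c j = ∑ j, φ (G.weight i j) * c j := by
  classical
  refine Finset.sum_subset (Finset.subset_univ _) fun j _ hj => ?_
  have h0 : G.weight i j = 0 := by
    by_contra h
    exact hj (Finset.mem_filter.2 ⟨Finset.mem_univ _, (G.weight_ne_zero_iff i j).1 h⟩)
  rw [h0, hφ, zero_mul]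

theorem sum_abs_weight_le (G : InteractionGraph n) (i : Fin n) :
    ∑ j, |G.weight i j| ≤ G.infNorm := by
  have h := G.sum_neighbors i (fun _ => 1) (fun a => |a|) abs_zero
  simp only [mul_one] at h
  rw [← h]
  exact le_ciSup (f := fun i => ∑ j ∈ G.neighbors i, |G.weight i j|)
    (Set.finite_range _).bddAbove i

theorem infNorm_nonneg (G : InteractionGraph n) (hn : 0 < n) : 0 ≤ G.infNorm :=
  (Finset.sum_nonneg fun _ _ => abs_nonneg _).trans (G.sum_abs_weight_le ⟨0, hn⟩)

/-- The graph with one node and a self-arc of weight `a`. -/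
def selfLoop (a : ℝ) (ha : a ≠ 0) : InteractionGraph 1 where
  arc _ _ := True
  weight _ _ := a
  weight_ne_zero_iff _ _ := by simp [ha]

theorem neighbors_selfLoop (a : ℝ) (ha : a ≠ 0) (i : Fin 1) :
    (selfLoop a ha).neighbors i = Finset.univ := by
  simp [neighbors, selfLoop]

theorem infNorm_selfLoop (a : ℝ) (ha : 0 < a) : (selfLoop a ha.ne').infNorm = a := by
  simp only [infNorm, neighbors_selfLoop]
  simp [selfLoop, abs_of_pos ha]

end InteractionGraph

/-! ### The growth inequality below the limit -/

/-- Below the limit the characteristic polynomial of the growth inequality has no real root. -/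
theorem exists_gap_of_lt {L : ℝ} (h1 : 1 ≤ L) (h2 : L < 3 / 2 + √2) :
    ∃ ε > 0, ∀ q ≥ 0, L * q ≤ (q + 1 / 2 - 2 * ε) * (1 + q) := by
  have hs : √L ^ 2 = L := Real.sq_sqrt (by linarith)
  have h22 : √2 ^ 2 = 2 := Real.sq_sqrt (by norm_num)
  have hs1 : 1 ≤ √L := Real.one_le_sqrt.2 h1
  have hlt : √L < 1 + √2 / 2 := by
    refine lt_of_pow_lt_pow_left₀ 2 (by positivity) ?_
    nlinarith
  refine ⟨(2 * √L - L - 1 / 2) / 2, ?_, fun q hq => ?_⟩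
  · have : (√L - 1) ^ 2 < 1 / 2 := by
      have h3 : √L - 1 < √2 / 2 := by linarith
      have h4 : 0 ≤ √L - 1 := by linarith
      nlinarith
    nlinarith
  · nlinarith [sq_nonneg (1 + q - √L)]

/-- If the range `E` grows by at least `h n` and at most `2 * h n` in step `n`, where `h n` is
either zero or at most `L * M n - E n / 2 + d` with `M` the running maximum of the increments,
then `E` is bounded, provided that `L` is below `3 / 2 + √2`. -/
theorem exists_bound_of_increment_le {L d : ℝ} {E M h : ℕ → ℝ} (h1 : 1 ≤ L)
    (h2 : L < 3 / 2 + √2) (hh : ∀ n, 0 ≤ h n) (hM0 : 0 ≤ M 0)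
    (hM : ∀ n, M (n + 1) = max (M n) (h n)) (hE : ∀ n, E n + h n ≤ E (n + 1))
    (hE' : ∀ n, E (n + 1) ≤ E n + 2 * h n)
    (hle : ∀ n, h n ≤ max 0 (L * M n - E n / 2 + d)) : ∃ B, ∀ n, E n ≤ B := by
  obtain ⟨ε, hε, hgap⟩ := exists_gap_of_lt h1 h2
  have hMmono : Monotone M := monotone_nat_of_le_succ fun n => by rw [hM]; exact le_max_left _ _
  have hEmono : Monotone E := monotone_nat_of_le_succ fun n => by linarith [hE n, hh n]
  have hMnn : ∀ n, 0 ≤ M n := fun n => hM0.trans (hMmono n.zero_le)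
  -- either there is no new record after `N`, or there is a first one
  have record : ∀ N, (∀ m ≥ N, M m = M N) ∨
      ∃ m ≥ N, M m = M N ∧ M m < h m ∧ M (m + 1) = h m := by
    intro N
    by_cases hrec : ∃ m, N ≤ m ∧ M m < h m
    · right
      classical
      obtain ⟨hm1, hm2⟩ := Nat.find_spec hrec
      have hmin := fun k hk => Nat.find_min (m := k) hrec hk
      set m := Nat.find hrec
      refine ⟨m, hm1, ?_, hm2, by rw [hM, max_eq_right hm2.le]⟩
      have : ∀ k, N ≤ k → k ≤ m → M k = M N := by
        intro k hk
        induction k, hk using Nat.le_induction with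
        | base => intro _; rfl
        | succ k hk ih =>
          intro hkm
          have h3 : h k ≤ M k := by
            by_contra hcon
            exact hmin k (by omega) ⟨hk, not_le.1 hcon⟩
          rw [hM, max_eq_left h3, ih (by omega)]
      exact this m hm1 le_rfl
    · left
      push Not at hrec
      intro m hm
      induction m, hm using Nat.le_induction with
      | base => rfl
      | succ k hk ih => rw [hM, max_eq_left (hrec k hk), ih]
  have bounded_of_const : ∀ N, (∀ m ≥ N, M m = M N) → ∃ B, ∀ m, M m ≤ B := by
    intro N hN
    refine ⟨M N, fun m => ?_⟩
    rcases le_total m N with hm | hm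
    · exact hMmono hm
    · exact (hN m hm).le
  have key : ∀ k : ℕ, ∀ N T, 0 < T → |d| ≤ ε * T → T + M N ≤ E N → M N ≤ k * ε * T →
      ∃ B, ∀ m, M m ≤ B := by
    intro k
    induction k with
    | zero =>
      intro N T hT hd hTE hMT
      have hMN : M N = 0 := le_antisymm (by simpa using hMT) (hMnn N)
      rcases record N with hN | ⟨m, hm, hm1, hm2, -⟩
      · exact bounded_of_const N hN
      · exfalso
        have h3 := hle m
        rw [hm1, hMN] at h3 hm2
        have h4 := hEmono hm
        have hg := hgap 0 le_rfl
        rw [le_max_iff] at h3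
        rcases h3 with h3 | h3
        · linarith
        · have : ε ≤ 1 / 4 := by linarith
          nlinarith [le_abs_self d]
    | succ k ih =>
      intro N T hT hd hTE hMT
      rcases record N with hN | ⟨m, hm, hm1, hm2, hm3⟩
      · exact bounded_of_const N hN
      · have hTm : T + M N ≤ E m := hTE.trans (hEmono hm)
        have hMN := hMnn N
        have hTm' : T ≤ E m := by linarith
        refine ih (m + 1) (E m) (by linarith) (hd.trans (by gcongr))
          (by rw [hm3]; exact hE m) ?_
        rw [hm3]
        have h3 : h m ≤ L * M N - E m / 2 + d := by
          rcases le_max_iff.1 (hle m) with h3 | h3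
          · linarith [hMnn m]
          · rwa [hm1] at h3
        set q := M N / T with hq
        have hqnn : 0 ≤ q := by positivity
        have hMq : M N = q * T := by rw [hq]; field_simp
        have hqk : q ≤ (k + 1) * ε := by
          rw [hq, div_le_iff₀ hT]; exact_mod_cast hMT
        have hg := hgap q hqnn
        have hco : 0 ≤ q + 1 / 2 - 2 * ε := by
          by_contra hcon
          have h5 : (q + 1 / 2 - 2 * ε) * (1 + q) < 0 :=
            mul_neg_of_neg_of_pos (not_le.1 hcon) (by linarith)
          have h6 : 0 ≤ L * q := by positivity
          linarith
        have h5 : L * M N ≤ (q + 1 / 2 - 2 * ε) * E m := by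
          calc L * M N = (L * q) * T := by rw [hMq]; ring
            _ ≤ (q + 1 / 2 - 2 * ε) * (1 + q) * T := by gcongr
            _ = (q + 1 / 2 - 2 * ε) * (T + M N) := by rw [hMq]; ring
            _ ≤ _ := by gcongr
        have h6 : d ≤ ε * E m := (le_abs_self d).trans (hd.trans (by gcongr))
        have h7 : q * E m ≤ (k + 1) * ε * E m := by
          have : 0 ≤ E m := by linarith
          gcongr
        nlinarith
  obtain ⟨B, hB⟩ : ∃ B, ∀ m, M m ≤ B := by
    by_cases hbig : ∃ n, 1 ≤ E n ∧ |d| ≤ ε * E n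
    · obtain ⟨n, hn1, hn2⟩ := hbig
      rcases record n with hN | ⟨m, hm, hm1, hm2, hm3⟩
      · exact bounded_of_const n hN
      · have hEm := hEmono hm
        obtain ⟨k, hk⟩ := exists_nat_ge (h m / (ε * E m))
        have hpos : 0 < ε * E m := mul_pos hε (by linarith)
        refine key k (m + 1) (E m) (by linarith) (hn2.trans (by gcongr))
          (by rw [hm3]; exact hE m) ?_
        rw [div_le_iff₀ hpos] at hk
        rw [hm3]; linarith
    · push Not at hbig
      have hEb : ∀ n, E n ≤ max 1 (|d| / ε) := by
        intro n
        rcases lt_or_ge (E n) 1 with h3 | h3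
        · exact h3.le.trans (le_max_left _ _)
        · refine le_trans ?_ (le_max_right _ _)
          rw [le_div_iff₀ hε]; linarith [hbig n h3]
      refine ⟨max (M 0) (max 1 (|d| / ε) - E 0), fun m => ?_⟩
      induction m with
      | zero => exact le_max_left _ _
      | succ m ih =>
        rw [hM]
        refine max_le ih (le_trans ?_ (le_max_right _ _))
        linarith [hE m, hEb (m + 1), hEmono m.zero_le]
  refine ⟨max (E 0) (2 * (L * B + |d|)), fun n => ?_⟩
  induction n with
  | zero => exact le_max_left _ _
  | succ n ih =>
    have hLB : L * M n ≤ L * B := by have := hB n; gcongr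
    have hLB0 : 0 ≤ L * M n := mul_nonneg (by linarith) (hMnn n)
    have hd := le_abs_self d
    rcases le_max_iff.1 (hle n) with h3 | h3
    · have : E (n + 1) ≤ E n := by linarith [hE' n]
      exact this.trans ih
    · refine le_trans ?_ (le_max_right _ _)
      linarith [hE' n, hh n]

/-! ### The stabilizing law -/

open Classical in
/-- The estimate recorded at a past state that is nearest to `y`. -/
noncomputable def nearestEstimate {n t : ℕ} (F : NetworkFlow n t) (y : ℝ) : ℝ :=
  if h : ∃ p : Fin t × Fin n, ∀ q : Fin t × Fin n,
      |y - F.X p.1.castSucc p.2| ≤ |y - F.X q.1.castSucc q.2|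
  then F.Z h.choose.1 h.choose.2 else 0

/-- The midpoint of the range of all states up to the present. -/
noncomputable def midrange {n t : ℕ} (F : NetworkFlow n t) : ℝ :=
  ((⨆ p : Fin (t + 1) × Fin n, F.X p.1 p.2) + ⨅ p : Fin (t + 1) × Fin n, F.X p.1 p.2) / 2

/-- The law that cancels the nearest-neighbor estimate of the network flow and steers to the
midrange of the states. -/
noncomputable def nearestNeighborLaw : LocalDecisionLaw := fun _ _ t F a =>
  midrange F - ∑ j, a j * nearestEstimate F (F.X (Fin.last t) j)

theorem abs_sub_nearestEstimate_le {n : ℕ} {f : ℝ → ℝ} {x z u : ℕ → Fin n → ℝ} {K C D : ℝ}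
    (hK : 0 ≤ K) (hf : ∀ a b, |f a - f b| ≤ K * |a - b| + C)
    (hz : ∀ t i, |f (x t i) - z t i| ≤ D) {t s : ℕ} (hs : s < t) (k : Fin n) (y : ℝ) :
    |f y - nearestEstimate (flowUpTo x z u t) y| ≤ K * |y - x s k| + C + D := by
  have : Nonempty (Fin t × Fin n) := ⟨(⟨s, hs⟩, k)⟩
  have hex : ∃ p : Fin t × Fin n, ∀ q : Fin t × Fin n,
      |y - (flowUpTo x z u t).X p.1.castSucc p.2| ≤ |y - (flowUpTo x z u t).X q.1.castSucc q.2| :=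
    Finite.exists_min fun p : Fin t × Fin n => |y - (flowUpTo x z u t).X p.1.castSucc p.2|
  rw [nearestEstimate, dif_pos hex]
  have hmin := hex.choose_spec (⟨s, hs⟩, k)
  set p := hex.choose
  change |y - x p.1 p.2| ≤ |y - x s k| at hmin
  change |f y - z p.1 p.2| ≤ _
  calc |f y - z p.1 p.2| ≤ |f y - f (x p.1 p.2)| + |f (x p.1 p.2) - z p.1 p.2| :=
        abs_sub_le _ _ _
    _ ≤ (K * |y - x p.1 p.2| + C) + D := add_le_add (hf _ _) (hz _ _)
    _ ≤ _ := by gcongr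

section Range

variable {n : ℕ} (x : ℕ → Fin n → ℝ)

/-- The largest state up to time `t`. -/
noncomputable def upperEnd (t : ℕ) : ℝ := ⨆ p : Fin (t + 1) × Fin n, x p.1 p.2

/-- The smallest state up to time `t`. -/
noncomputable def lowerEnd (t : ℕ) : ℝ := ⨅ p : Fin (t + 1) × Fin n, x p.1 p.2

variable {x}

theorem le_upperEnd {s t : ℕ} (hs : s ≤ t) (j : Fin n) : x s j ≤ upperEnd x t :=
  le_ciSup (f := fun p : Fin (t + 1) × Fin n => x p.1 p.2) (Set.finite_range _).bddAbove
    (⟨s, by omega⟩, j)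

theorem lowerEnd_le {s t : ℕ} (hs : s ≤ t) (j : Fin n) : lowerEnd x t ≤ x s j :=
  ciInf_le (f := fun p : Fin (t + 1) × Fin n => x p.1 p.2) (Set.finite_range _).bddBelow
    (⟨s, by omega⟩, j)

theorem exists_eq_upperEnd (hn : 0 < n) (x : ℕ → Fin n → ℝ) (t : ℕ) :
    ∃ s ≤ t, ∃ j, x s j = upperEnd x t := by
  have : Nonempty (Fin n) := ⟨⟨0, hn⟩⟩
  obtain ⟨p, hp⟩ := exists_eq_ciSup_of_finite (f := fun p : Fin (t + 1) × Fin n => x p.1 p.2)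
  exact ⟨p.1, by omega, p.2, hp⟩

theorem exists_eq_lowerEnd (hn : 0 < n) (x : ℕ → Fin n → ℝ) (t : ℕ) :
    ∃ s ≤ t, ∃ j, x s j = lowerEnd x t := by
  have : Nonempty (Fin n) := ⟨⟨0, hn⟩⟩
  obtain ⟨p, hp⟩ := exists_eq_ciInf_of_finite (f := fun p : Fin (t + 1) × Fin n => x p.1 p.2)
  exact ⟨p.1, by omega, p.2, hp⟩

theorem upperEnd_le_succ (hn : 0 < n) (x : ℕ → Fin n → ℝ) (t : ℕ) :
    upperEnd x t ≤ upperEnd x (t + 1) := by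
  obtain ⟨s, hs, j, h⟩ := exists_eq_upperEnd hn x t
  exact h ▸ le_upperEnd (by omega) j

theorem lowerEnd_succ_le (hn : 0 < n) (x : ℕ → Fin n → ℝ) (t : ℕ) :
    lowerEnd x (t + 1) ≤ lowerEnd x t := by
  obtain ⟨s, hs, j, h⟩ := exists_eq_lowerEnd hn x t
  exact h ▸ lowerEnd_le (by omega) j

variable (x) in
/-- The larger of the two extensions of the range of the states at time `t + 1`. -/
noncomputable def extension (t : ℕ) : ℝ :=
  max (upperEnd x (t + 1) - upperEnd x t) (lowerEnd x t - lowerEnd x (t + 1))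

variable (x) in
/-- The largest extension of the range up to time `t`, which bounds the gaps between the states. -/
noncomputable def maxGap : ℕ → ℝ
  | 0 => upperEnd x 0 - lowerEnd x 0
  | t + 1 => max (maxGap t) (extension x t)

theorem extension_le (hn : 0 < n) {t : ℕ} {m b : ℝ} (hm : m = (upperEnd x t + lowerEnd x t) / 2)
    (hb : ∀ i, |x (t + 1) i - m| ≤ b) :
    extension x t ≤ max 0 (b - (upperEnd x t - lowerEnd x t) / 2) := by
  refine max_le ?_ ?_
  · obtain ⟨s, hs, j, h⟩ := exists_eq_upperEnd hn x (t + 1)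
    rw [← h]
    rcases Nat.le_succ_iff.1 hs with hs | rfl
    · exact le_max_of_le_left (by linarith [le_upperEnd (x := x) hs j])
    · exact le_max_of_le_right (by linarith [(abs_le.1 (hb j)).2])
  · obtain ⟨s, hs, j, h⟩ := exists_eq_lowerEnd hn x (t + 1)
    rw [← h]
    rcases Nat.le_succ_iff.1 hs with hs | rfl
    · exact le_max_of_le_left (by linarith [lowerEnd_le (x := x) hs j])
    · exact le_max_of_le_right (by linarith [(abs_le.1 (hb j)).1])

theorem exists_near_state (hn : 0 < n) (x : ℕ → Fin n → ℝ) (t : ℕ) {y : ℝ}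
    (h1 : lowerEnd x (t + 1) ≤ y) (h2 : y ≤ upperEnd x (t + 1)) :
    ∃ s ≤ t, ∃ j, |y - x s j| ≤ maxGap x (t + 1) := by
  induction t generalizing y with
  | zero =>
    rcases lt_or_ge (upperEnd x 0) y with h | h
    · obtain ⟨s, hs, j, hj⟩ := exists_eq_upperEnd hn x 0
      refine ⟨s, hs, j, ?_⟩
      rw [hj, abs_of_pos (by linarith)]
      exact le_max_of_le_right (le_max_of_le_left (by linarith))
    · rcases lt_or_ge y (lowerEnd x 0) with h' | h'
      · obtain ⟨s, hs, j, hj⟩ := exists_eq_lowerEnd hn x 0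
        refine ⟨s, hs, j, ?_⟩
        rw [hj, abs_of_neg (by linarith)]
        exact le_max_of_le_right (le_max_of_le_right (by linarith))
      · obtain ⟨s, hs, j, hj⟩ := exists_eq_upperEnd hn x 0
        refine ⟨s, hs, j, ?_⟩
        rw [hj, abs_of_nonpos (by linarith)]
        exact le_max_of_le_left (by simp only [maxGap]; linarith)
  | succ t ih =>
    rcases lt_or_ge (upperEnd x (t + 1)) y with h | h
    · obtain ⟨s, hs, j, hj⟩ := exists_eq_upperEnd hn x (t + 1)
      refine ⟨s, hs, j, ?_⟩
      rw [hj, abs_of_pos (by linarith)]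
      exact le_max_of_le_right (le_max_of_le_left (by linarith))
    · rcases lt_or_ge y (lowerEnd x (t + 1)) with h' | h'
      · obtain ⟨s, hs, j, hj⟩ := exists_eq_lowerEnd hn x (t + 1)
        refine ⟨s, hs, j, ?_⟩
        rw [hj, abs_of_neg (by linarith)]
        exact le_max_of_le_right (le_max_of_le_right (by linarith))
      · obtain ⟨s, hs, j, hj⟩ := ih h' h
        exact ⟨s, by omega, j, le_max_of_le_left hj⟩

end Range

theorem abs_sum_weight_mul_le {n : ℕ} (G : InteractionGraph n) (i : Fin n) {c : Fin n → ℝ} {b : ℝ}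
    (hb : 0 ≤ b) (hc : ∀ j, |c j| ≤ b) : |∑ j, G.weight i j * c j| ≤ G.infNorm * b := by
  calc |∑ j, G.weight i j * c j| ≤ ∑ j, |G.weight i j * c j| := Finset.abs_sum_le_sum_abs _ _
    _ ≤ ∑ j, |G.weight i j| * b := Finset.sum_le_sum fun j _ => by
        rw [abs_mul]; exact mul_le_mul_of_nonneg_left (hc j) (abs_nonneg _)
    _ = (∑ j, |G.weight i j|) * b := (Finset.sum_mul _ _ _).symm
    _ ≤ _ := mul_le_mul_of_nonneg_right (G.sum_abs_weight_le i) hb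

theorem nearestNeighborLaw_stabilizes {L : ℝ} (hL : 0 < L) {n : ℕ} (G : InteractionGraph n)
    (hn : 0 < n) (hG : L * G.infNorm < 3 / 2 + √2) {f : ℝ → ℝ} (hf : f ∈ functionClass L) :
    Stabilizes nearestNeighborLaw G f := by
  rintro w z x u ⟨⟨W, hW0, hW⟩, ⟨D, hD⟩, hu, hdyn⟩ i₀
  set α := G.infNorm with hα
  have hα0 : 0 ≤ α := G.infNorm_nonneg hn
  obtain ⟨K, hLK, hKα⟩ : ∃ K > L, K * α < 3 / 2 + √2 := by
    set c := 3 / 2 + √2 - L * α with hc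
    have hc0 : 0 < c := by linarith
    refine ⟨L + c / (2 * (α + 1)), by simp only [gt_iff_lt, lt_add_iff_pos_right]; positivity, ?_⟩
    have : c / (2 * (α + 1)) * α < c := by
      rw [div_mul_eq_mul_div, div_lt_iff₀ (by positivity)]
      nlinarith
    linarith
  have hK0 : 0 < K := hL.trans hLK
  obtain ⟨C, hC⟩ := exists_affine_bound_of_mem_functionClass hL hf hLK
  have hC0 : 0 ≤ C := by simpa using hC 0 0
  have hD0 : 0 ≤ D := (abs_nonneg _).trans (hD 0 i₀)
  have hsum : ∀ t i, x (t + 1) i = ∑ j, G.weight i j * f (x t j) + u t i + w t i := by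
    intro t i
    rw [hdyn, ← G.sum_neighbors i (fun j => f (x t j)) (fun a => a) rfl]
  have hstep : ∀ t i, x (t + 1) i - (upperEnd x t + lowerEnd x t) / 2 =
      ∑ j, G.weight i j * (f (x t j) - nearestEstimate (flowUpTo x z u t) (x t j)) + w t i := by
    intro t i
    have h1 : u t i = (upperEnd x t + lowerEnd x t) / 2 -
        ∑ j, G.weight i j * nearestEstimate (flowUpTo x z u t) (x t j) := hu t i
    rw [hsum, h1]
    simp only [mul_sub, Finset.sum_sub_distrib]
    ring
  have hext0 : ∀ t, 0 ≤ extension x t := fun t =>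
    le_max_of_le_left (sub_nonneg.2 (upperEnd_le_succ hn x t))
  have hgap0 : 0 ≤ maxGap x 0 :=
    sub_nonneg.2 ((lowerEnd_le le_rfl ⟨0, hn⟩).trans (le_upperEnd (le_refl 0) ⟨0, hn⟩))
  have hgap : ∀ t, 0 ≤ maxGap x t := by
    intro t
    cases t with
    | zero => exact hgap0
    | succ t => exact le_max_of_le_right (hext0 t)
  set d₁ := α * (C + D) + W
  set d₀ := extension x 0 + (upperEnd x 0 - lowerEnd x 0) / 2
  obtain ⟨B, hB⟩ := exists_bound_of_increment_le (L := max (K * α) 1) (d := max d₀ d₁)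
    (E := fun t => upperEnd x t - lowerEnd x t) (M := maxGap x) (h := extension x)
    (le_max_right _ _)
    (max_lt hKα (by linarith [Real.sqrt_nonneg 2])) hext0 hgap0 (fun _ => rfl)
    (fun t => by
      rcases max_choice (upperEnd x (t + 1) - upperEnd x t) (lowerEnd x t - lowerEnd x (t + 1))
        with h | h <;> rw [extension, h] <;>
        linarith [upperEnd_le_succ hn x t, lowerEnd_succ_le hn x t])
    (fun t => by
      have h1 : _ ≤ extension x t := le_max_left _ _
      have h2 : _ ≤ extension x t := le_max_right _ _
      linarith)
    (fun t => by
      cases t with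
      | zero =>
        refine le_max_of_le_right ?_
        have h1 : 0 ≤ max (K * α) 1 * maxGap x 0 :=
          mul_nonneg (le_max_of_le_right zero_le_one) hgap0
        have h2 : d₀ ≤ max d₀ d₁ := le_max_left _ _
        simp only [d₀] at h2 ⊢
        linarith
      | succ t =>
        refine (extension_le hn rfl (b := α * (K * maxGap x (t + 1) + C + D) + W)
          fun i => ?_).trans (max_le_max le_rfl ?_)
        · rw [hstep]
          refine (abs_add_le _ _).trans (add_le_add (abs_sum_weight_mul_le G i ?_ fun j => ?_)
            (hW _ _))
          · have := hgap (t + 1)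
            positivity
          · obtain ⟨s, hs, k, hk⟩ := exists_near_state hn x t
              (lowerEnd_le (le_refl (t + 1)) j) (le_upperEnd (le_refl (t + 1)) j)
            refine (abs_sub_nearestEstimate_le hK0.le hC hD (by omega : s < t + 1) k _).trans ?_
            gcongr
        · have h1 : K * α * maxGap x (t + 1) ≤ max (K * α) 1 * maxGap x (t + 1) :=
            mul_le_mul_of_nonneg_right (le_max_left _ _) (hgap _)
          have h2 : d₁ ≤ max d₀ d₁ := le_max_right _ _
          simp only [d₁] at h2 ⊢
          linarith)
  have hx : ∀ t i, |x t i| ≤ |x 0 i₀| + B := by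
    intro t i
    have h1 := lowerEnd_le (x := x) (le_refl t) i
    have h2 := le_upperEnd (x := x) (le_refl t) i
    have h3 := lowerEnd_le (x := x) t.zero_le i₀
    have h4 := le_upperEnd (x := x) t.zero_le i₀
    have h5 : |x t i - x 0 i₀| ≤ B := abs_le.2 ⟨by linarith [hB t], by linarith [hB t]⟩
    linarith [abs_sub_abs_le_abs_sub (x t i) (x 0 i₀)]
  set R := |x 0 i₀| + B
  have hR : 0 ≤ R := (abs_nonneg _).trans (hx 0 i₀)
  have hfx : ∀ t i, |f (x t i)| ≤ |f 0| + (K * R + C) := by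
    intro t i
    have h1 := hC (x t i) 0
    rw [sub_zero] at h1
    have h2 : K * |x t i| ≤ K * R := by have := hx t i; gcongr
    linarith [abs_sub_abs_le_abs_sub (f (x t i)) (f 0)]
  refine ⟨R + (R + α * (|f 0| + (K * R + C)) + W), ?_⟩
  rintro _ ⟨t, rfl⟩
  refine add_le_add (hx t i₀) ?_
  have h1 : u t i₀ = x (t + 1) i₀ - ∑ j, G.weight i₀ j * f (x t j) - w t i₀ := by
    rw [hsum]; ring
  rw [h1]
  have h2 := abs_sum_weight_mul_le G i₀ (b := |f 0| + (K * R + C)) (by positivity) (hfx t)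
  calc _ ≤ |x (t + 1) i₀ - ∑ j, G.weight i₀ j * f (x t j)| + |w t i₀| := abs_sub _ _
    _ ≤ |x (t + 1) i₀| + |∑ j, G.weight i₀ j * f (x t j)| + |w t i₀| := by
      gcongr; exact abs_sub _ _
    _ ≤ _ := add_le_add (add_le_add (hx _ _) h2) (hW _ _)

/-! ### The adversary above the limit -/

/-- The limit `3 / 2 + √2`. -/
noncomputable def criticalSlope : ℝ := 3 / 2 + √2

/-- The states `x 0, …, x t` and the values `v 0, …, v (t - 1)` at the first `t` of them are
consistent with a Lipschitz function of critical slope, `x t` extends the range of the earlier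
states, and the extension is a sufficient part of the range, which grows linearly. -/
def IsExpanding (t : ℕ) (x v : ℕ → ℝ) : Prop :=
  (∀ r < t, ∀ s < t, |v r - v s| ≤ criticalSlope * |x r - x s|) ∧
  ∃ r < t, (∀ s < t, |x t - x s| = |x t - x r| + |x r - x s|) ∧
  ∃ i ≤ t, ∃ j ≤ t, (∀ s ≤ t, x i ≤ x s ∧ x s ≤ x j) ∧
    (t + 1 : ℝ) ≤ 2 * (x j - x i) ∧ (√2 - 1) * (x j - x i) ≤ |x t - x r|

theorem IsExpanding.congr {t : ℕ} {x v y w : ℕ → ℝ} (h : IsExpanding t x v)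
    (hx : ∀ s ≤ t, y s = x s) (hv : ∀ s < t, w s = v s) : IsExpanding t y w := by
  obtain ⟨h1, r, hr, h2, i, hi, j, hj, h3, h4, h5⟩ := h
  refine ⟨fun a ha b hb => ?_, r, hr, fun s hs => ?_, i, hi, j, hj, fun s hs => ?_, ?_, ?_⟩
  · rw [hv a ha, hv b hb, hx a ha.le, hx b hb.le]; exact h1 a ha b hb
  · rw [hx t le_rfl, hx s hs.le, hx r hr.le]; exact h2 s hs
  · rw [hx i hi, hx j hj, hx s hs]; exact h3 s hs
  · rw [hx i hi, hx j hj]; exact h4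
  · rw [hx i hi, hx j hj, hx t le_rfl, hx r hr.le]; exact h5

theorem IsExpanding.neg {t : ℕ} {x v : ℕ → ℝ} (h : IsExpanding t x v) :
    IsExpanding t (-x) (-v) := by
  obtain ⟨h1, r, hr, h2, i, hi, j, hj, h3, h4, h5⟩ := h
  have e : ∀ a b : ℝ, |-a - -b| = |a - b| := fun a b => by rw [neg_sub_neg, abs_sub_comm]
  refine ⟨fun a ha b hb => ?_, r, hr, fun s hs => ?_, j, hj, i, hi, fun s hs => ?_, ?_, ?_⟩ <;>
    simp only [Pi.neg_apply, e]
  · exact h1 a ha b hb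
  · exact h2 s hs
  · exact ⟨neg_le_neg (h3 s hs).2, neg_le_neg (h3 s hs).1⟩
  · linarith
  · linarith

theorem isExpanding_one {x v : ℕ → ℝ} (h : x 1 = x 0 + 1) : IsExpanding 1 x v := by
  have h22 : √2 ^ 2 = 2 := Real.sq_sqrt (by norm_num)
  refine ⟨fun r hr s hs => ?_, 0, one_pos, fun s hs => ?_, 0, zero_le_one, 1, le_rfl,
    fun s hs => ?_, ?_, ?_⟩
  · obtain rfl : r = 0 := by omega
    obtain rfl : s = 0 := by omega
    simp
  · obtain rfl : s = 0 := by omega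
    simp
  · interval_cases s <;> constructor <;> linarith
  · rw [h]; norm_num
  · rw [h]; simp only [add_sub_cancel_left, abs_one]; nlinarith

/-- A value at `x t` within the critical slope keeps the values consistent. -/
theorem consistent_succ {t r : ℕ} {x v : ℕ → ℝ} (hr : r < t)
    (h1 : ∀ r < t, ∀ s < t, |v r - v s| ≤ criticalSlope * |x r - x s|)
    (h2 : ∀ s < t, |x t - x s| = |x t - x r| + |x r - x s|)
    (hv : |v t - v r| ≤ criticalSlope * |x t - x r|) :
    ∀ a < t + 1, ∀ b < t + 1, |v a - v b| ≤ criticalSlope * |x a - x b| := by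
  have key : ∀ s < t, |v t - v s| ≤ criticalSlope * |x t - x s| := by
    intro s hs
    rw [h2 s hs, mul_add]
    exact (abs_sub_le _ (v r) _).trans (add_le_add hv (h1 r hr s hs))
  intro a ha b hb
  rcases Nat.lt_succ_iff_lt_or_eq.1 ha with ha | rfl <;>
    rcases Nat.lt_succ_iff_lt_or_eq.1 hb with hb | rfl
  · exact h1 a ha b hb
  · rw [abs_sub_comm, abs_sub_comm (x a)]; exact key a ha
  · exact key b hb
  · simp

/-- If the input does not steer to the left of the middle of the range, the adversary extends the
range to the right. -/
theorem isExpanding_succ {t r i j : ℕ} {x v : ℕ → ℝ} {u : ℝ} (hr : r < t)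
    (h1 : ∀ r < t, ∀ s < t, |v r - v s| ≤ criticalSlope * |x r - x s|)
    (h2 : ∀ s < t, |x t - x s| = |x t - x r| + |x r - x s|) (hi : i ≤ t) (hj : j ≤ t)
    (h3 : ∀ s ≤ t, x i ≤ x s ∧ x s ≤ x j) (h4 : (t + 1 : ℝ) ≤ 2 * (x j - x i))
    (h5 : (√2 - 1) * (x j - x i) ≤ |x t - x r|) (hv : v t = v r + criticalSlope * |x t - x r|)
    (hx : x (t + 1) = v t + u) (hu : (x i + x j) / 2 ≤ v r + u) : IsExpanding (t + 1) x v := by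
  have h22 : √2 ^ 2 = 2 := Real.sq_sqrt (by norm_num)
  have h2pos : 0 < √2 := by positivity
  have h2one : 1 ≤ √2 := by nlinarith
  have h2two : √2 ≤ 2 := by nlinarith
  have ht : (1 : ℝ) ≤ t := by exact_mod_cast (by omega : 1 ≤ t)
  have hK : 0 ≤ criticalSlope := by unfold criticalSlope; positivity
  set S := x j - x i with hS
  set g := x (t + 1) - x j with hg
  have hgS : √2 / 2 * S ≤ g := by
    have h6 : criticalSlope * ((√2 - 1) * S) ≤ criticalSlope * |x t - x r| := by gcongr
    have h7 : criticalSlope * ((√2 - 1) * S) = (1 / 2 + √2 / 2) * S := by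
      unfold criticalSlope; linear_combination S * h22
    linarith
  have hS1 : 1 ≤ S := by linarith
  have hg0 : 0 ≤ g := le_trans (by positivity) hgS
  refine ⟨consistent_succ hr h1 h2 ?_, j, by omega, fun s hs => ?_, i, by omega, t + 1, le_rfl,
    fun s hs => ?_, ?_, ?_⟩
  · rw [hv, add_sub_cancel_left, abs_of_nonneg (by positivity)]
  · have h6 := (h3 s (by omega)).2
    rw [abs_of_nonneg (by linarith : 0 ≤ x (t + 1) - x s), abs_of_nonneg hg0,
      abs_of_nonneg (by linarith : 0 ≤ x j - x s)]
    ring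
  · rcases Nat.le_succ_iff.1 hs with hs | rfl
    · exact ⟨(h3 s hs).1, by linarith [(h3 s hs).2]⟩
    · exact ⟨by linarith, le_rfl⟩
  · push_cast
    nlinarith
  · rw [abs_of_nonneg hg0]
    have h6 : x (t + 1) - x i = S + g := by rw [hS, hg]; ring
    rw [h6]
    nlinarith [mul_le_mul_of_nonneg_left hgS (by linarith : 0 ≤ 2 - √2)]

/-- Whatever the input is, the adversary can continue an expanding trajectory. -/
theorem exists_expanding_value (t : ℕ) (x v : ℕ → ℝ) (u : ℝ) (h : t = 0 ∨ IsExpanding t x v) :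
    ∃ a : ℝ, ∀ y w : ℕ → ℝ, (∀ s ≤ t, y s = x s) → (∀ s < t, w s = v s) → w t = a →
      y (t + 1) = a + u → IsExpanding (t + 1) y w := by
  rcases h with rfl | h
  · refine ⟨x 0 + 1 - u, fun y w hy _ _ h => isExpanding_one ?_⟩
    rw [zero_add] at h
    rw [h, hy 0 le_rfl]; ring
  · have right : ∀ {x v : ℕ → ℝ} {u : ℝ} {r i j : ℕ}, r < t → i ≤ t → j ≤ t →
        (x i + x j) / 2 ≤ v r + u →
        (∀ r < t, ∀ s < t, |v r - v s| ≤ criticalSlope * |x r - x s|) →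
        (∀ s < t, |x t - x s| = |x t - x r| + |x r - x s|) →
        (∀ s ≤ t, x i ≤ x s ∧ x s ≤ x j) → (t + 1 : ℝ) ≤ 2 * (x j - x i) →
        (√2 - 1) * (x j - x i) ≤ |x t - x r| →
        ∃ a : ℝ, ∀ y w : ℕ → ℝ, (∀ s ≤ t, y s = x s) → (∀ s < t, w s = v s) → w t = a →
          y (t + 1) = a + u → IsExpanding (t + 1) y w := by
      intro x v u r i j hr hi hj hu h1 h2 h3 h4 h5
      refine ⟨v r + criticalSlope * |x t - x r|, fun y w hy hw hwt hyt => ?_⟩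
      refine (isExpanding_succ (x := fun s => if s ≤ t then x s else y s)
        (v := fun s => if s < t then v s else w s) (u := u) (r := r) (i := i) (j := j)
        hr ?_ ?_ hi hj ?_ ?_ ?_ ?_ ?_ ?_).congr ?_ ?_
      · intro a ha b hb
        simpa [ha, hb, ha.le, hb.le] using h1 a ha b hb
      · intro s hs
        simpa [hs.le, hr.le] using h2 s hs
      · intro s hs
        simpa [hs, hi, hj] using h3 s hs
      · simpa [hi, hj] using h4
      · simpa [hi, hj, hr.le] using h5
      · simpa [hr, hr.le] using hwt
      · simpa [hwt] using hyt
      · simpa [hi, hj, hr] using hu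
      · intro s _
        by_cases h : s ≤ t
        · simp [h, hy s h]
        · simp [h]
      · intro s _
        by_cases h : s < t
        · simp [h, hw s h]
        · simp [h]
    have hneg := h.neg
    obtain ⟨h1, r, hr, h2, i, hi, j, hj, h3, h4, h5⟩ := h
    rcases le_total ((x i + x j) / 2) (v r + u) with hu | hu
    · exact right hr hi hj hu h1 h2 h3 h4 h5
    · have e : ∀ a b : ℝ, |-a - -b| = |a - b| := fun a b => by
        rw [neg_sub_neg, abs_sub_comm]
      obtain ⟨a, ha⟩ := right (x := -x) (v := -v) (u := -u) (r := r) (i := j) (j := i) hr hj hi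
        (by simp only [Pi.neg_apply]; linarith) hneg.1
        (fun s hs => by simpa only [Pi.neg_apply, e] using h2 s hs)
        (fun s hs => ⟨neg_le_neg (h3 s hs).2, neg_le_neg (h3 s hs).1⟩)
        (by simp only [Pi.neg_apply]; linarith)
        (by simp only [Pi.neg_apply, e]; linarith)
      refine ⟨-a, fun y w hy hw hwt hyt => ?_⟩
      have := (ha (-y) (-w) (fun s hs => by simp [hy s hs]) (fun s hs => by simp [hw s hs])
        (by simp [hwt]) (by simp [hyt]; ring)).neg
      simpa using this

open Classical in
/-- A value with which the adversary continues an expanding trajectory, if there is one. -/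
noncomputable def expandingValue (t : ℕ) (x v : ℕ → ℝ) (u : ℝ) : ℝ :=
  if h : t = 0 ∨ IsExpanding t x v then (exists_expanding_value t x v u h).choose else 0

theorem exists_strong_recursion {β : Type*} (step : (t : ℕ) → ((s : ℕ) → s < t → β) → β) :
    ∃ p : ℕ → β, ∀ t, p t = step t fun s _ => p s :=
  ⟨fun t => WellFounded.fix (r := (· < ·)) Nat.lt_wfRel.wf step t,
    fun t => WellFounded.fix_eq (r := (· < ·)) Nat.lt_wfRel.wf step t⟩

/-- Against every causal control the adversary has a strategy that leads to an expanding
trajectory. -/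
theorem exists_expanding_trajectory (c : ℕ → (ℕ → ℝ) → (ℕ → ℝ) → (ℕ → ℝ) → ℝ)
    (hc : ∀ t x v u y w m, (∀ s ≤ t, y s = x s) → (∀ s < t, w s = v s) → (∀ s < t, m s = u s) →
      c t y w m = c t x v u) (x₀ : ℝ) :
    ∃ x v u : ℕ → ℝ, x 0 = x₀ ∧ (∀ t, u t = c t x v u) ∧ (∀ t, x (t + 1) = v t + u t) ∧
      ∀ t, IsExpanding (t + 1) x v := by
  let state (q : ℕ → ℝ × ℝ) : ℕ → ℝ
    | 0 => x₀
    | s + 1 => (q s).1 + (q s).2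
  let input (t : ℕ) (q : ℕ → ℝ × ℝ) : ℝ :=
    c t (state q) (fun s => (q s).1) (fun s => (q s).2)
  obtain ⟨p, hp⟩ := exists_strong_recursion (β := ℝ × ℝ) fun t past =>
    let q : ℕ → ℝ × ℝ := fun s => if h : s < t then past s h else 0
    (expandingValue t (state q) (fun s => (q s).1) (input t q), input t q)
  let q (t : ℕ) : ℕ → ℝ × ℝ := fun s => if s < t then p s else 0
  have hq : ∀ t, ∀ s < t, p s = q t s := fun t s hs => by simp [q, hs]
  have hstate : ∀ t, ∀ s ≤ t, state p s = state (q t) s := by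
    intro t s hs
    cases s with
    | zero => rfl
    | succ s => simp only [state, hq t s hs]
  have hp' : ∀ t, p t = (expandingValue t (state (q t)) (fun s => (q t s).1) (input t (q t)),
      input t (q t)) := hp
  have hu : ∀ t, (p t).2 = input t (q t) := fun t => by rw [hp']
  refine ⟨state p, fun t => (p t).1, fun t => (p t).2, rfl, fun t => ?_, fun t => rfl, ?_⟩
  · change (p t).2 = _
    rw [hu]
    exact (hc _ _ _ _ _ _ _ (hstate t) (fun s hs => by rw [hq t s hs])
      (fun s hs => by rw [hq t s hs])).symm
  · have step : ∀ t, (t = 0 ∨ IsExpanding t (state p) fun s => (p s).1) →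
        IsExpanding (t + 1) (state p) fun s => (p s).1 := by
      intro t ht
      have ht' : t = 0 ∨ IsExpanding t (state (q t)) fun s => (q t s).1 :=
        ht.imp_right fun h => h.congr (fun s hs => (hstate t s hs).symm)
          (fun s hs => by rw [hq t s hs])
      have hspec := (exists_expanding_value t (state (q t)) (fun s => (q t s).1)
        (input t (q t)) ht').choose_spec
      refine hspec _ _ (hstate t) (fun s hs => by rw [hq t s hs]) ?_ ?_
      · rw [hp', expandingValue, dif_pos ht']
      · change (p t).1 + (p t).2 = _
        rw [hp', expandingValue, dif_pos ht']
    intro t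
    induction t with
    | zero => exact step 0 (Or.inl rfl)
    | succ t ih => exact step (t + 1) (Or.inr ih)

theorem exists_lipschitz_of_consistent {x v : ℕ → ℝ} {K : ℝ} (hK : 0 ≤ K)
    (h : ∀ r s, |v r - v s| ≤ K * |x r - x s|) :
    ∃ g : ℝ → ℝ, (∀ a b, |g a - g b| ≤ K * |a - b|) ∧ ∀ t, g (x t) = v t := by
  have hinv : ∀ t, v (Function.invFun x (x t)) = v t := by
    intro t
    have h1 := h (Function.invFun x (x t)) t
    rw [Function.invFun_eq (f := x) ⟨t, rfl⟩, sub_self, abs_zero, mul_zero] at h1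
    exact sub_eq_zero.1 (abs_nonpos_iff.1 h1)
  have hlip : LipschitzOnWith ⟨K, hK⟩ (fun y => v (Function.invFun x y)) (Set.range x) := by
    refine LipschitzOnWith.of_dist_le_mul ?_
    rintro _ ⟨r, rfl⟩ _ ⟨s, rfl⟩
    simp only [hinv, Real.dist_eq]
    exact h r s
  obtain ⟨g, hg, hgx⟩ := hlip.extend_real
  refine ⟨g, fun a b => ?_, fun t => ?_⟩
  · exact hg.dist_le_mul a b
  · rw [← hgx ⟨t, rfl⟩]; exact hinv t

theorem limsup_eq_top_of_isExpanding {x : ℕ → Fin 1 → ℝ} {v : ℕ → ℝ}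
    (h : ∀ t, IsExpanding (t + 1) (fun s => x s 0) v) :
    limsup (fun t => ⨆ i, ENNReal.ofReal |x t i|) atTop = ⊤ := by
  by_contra hne
  obtain ⟨c, hc1, hc2⟩ := exists_between (lt_top_iff_ne_top.2 hne)
  have hev := eventually_lt_of_limsup_lt hc1
  have hbdd : BddAbove (Set.range fun t => |x t 0|) := by
    refine Filter.IsBoundedUnder.bddAbove_range ⟨c.toReal, ?_⟩
    rw [eventually_map]
    filter_upwards [hev] with t ht
    have h1 : ENNReal.ofReal |x t 0| ≤ c :=
      (le_iSup (fun i => ENNReal.ofReal |x t i|) 0).trans ht.le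
    exact (ENNReal.ofReal_le_iff_le_toReal hc2.ne).1 h1
  obtain ⟨B, hB⟩ := hbdd
  obtain ⟨t, ht⟩ := exists_nat_gt (4 * B)
  obtain ⟨-, r, -, -, i, -, j, -, -, h4, -⟩ := h t
  have hi : |x i 0| ≤ B := hB ⟨i, rfl⟩
  have hj : |x j 0| ≤ B := hB ⟨j, rfl⟩
  push_cast at h4
  linarith [neg_le_of_abs_le hi, le_of_abs_le hj]

theorem exists_unbounded_closedLoop {L α : ℝ} (hα : 0 < α) (hL : 3 / 2 + √2 ≤ L * α)
    (h : LocalDecisionLaw) (x₀ : Fin 1 → ℝ) :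
    ∃ f ∈ functionClass L, ∃ w z x u : ℕ → Fin 1 → ℝ,
      IsClosedLoop h (InteractionGraph.selfLoop α hα.ne') f w z x u ∧ x 0 = x₀ ∧
        limsup (fun t => ⨆ i, ENNReal.ofReal |x t i|) atTop = ⊤ := by
  set G := InteractionGraph.selfLoop α hα.ne'
  obtain ⟨x, v, u, hx0, hu, hx, hexp⟩ := exists_expanding_trajectory
    (fun t x v u => h 1 0 t (flowUpTo (fun s _ => x s) (fun s _ => v s / α) (fun s _ => u s) t)
      (G.localWeights 0))
    (fun t x v u y w m h1 h2 h3 => by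
      congr 1
      simp only [flowUpTo, NetworkFlow.mk.injEq]
      refine ⟨?_, ?_, ?_⟩ <;> funext s _
      · exact h1 s (by omega)
      · rw [h2 s s.2]
      · exact h3 s s.2) (x₀ 0)
  have hK : 0 ≤ criticalSlope := by unfold criticalSlope; positivity
  obtain ⟨g, hg, hgx⟩ := exists_lipschitz_of_consistent (x := x) (v := v) hK fun r s =>
    (hexp (max r s)).1 r (by omega) s (by omega)
  have hL0 : 0 ≤ L := by
    by_contra hneg
    have := mul_neg_of_neg_of_pos (not_le.1 hneg) hα
    linarith [Real.sqrt_nonneg 2]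
  refine ⟨fun a => g a / α, mem_functionClass_of_lipschitz hL0 fun a b => ?_,
    fun _ _ => 0, fun t _ => v t / α, fun t _ => x t, fun t _ => u t, ⟨⟨1, one_pos, ?_⟩,
      ⟨0, ?_⟩, ?_, ?_⟩, ?_, limsup_eq_top_of_isExpanding hexp⟩
  · rw [← sub_div, abs_div, abs_of_pos hα, div_le_iff₀ hα]
    refine (hg a b).trans ?_
    have : criticalSlope * |a - b| ≤ L * α * |a - b| := by
      unfold criticalSlope; gcongr
    linarith
  · intro t i; simp
  · intro t i; simp [hgx]
  · intro t i
    obtain rfl : i = 0 := Subsingleton.elim _ _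
    exact hu t
  · intro t i
    rw [InteractionGraph.neighbors_selfLoop]
    simp only [Finset.univ_unique, Finset.sum_singleton, hgx, hx]
    change _ = α * (v t / α) + u t + 0
    field_simp
    ring
  · funext i
    obtain rfl : i = 0 := Subsingleton.elim _ _
    exact hx0

theorem not_stabilizes_of_limsup_eq_top {h : LocalDecisionLaw} {n : ℕ} {G : InteractionGraph n}
    {f : ℝ → ℝ} {w z x u : ℕ → Fin n → ℝ} (hcl : IsClosedLoop h G f w z x u)
    (hx : limsup (fun t => ⨆ i, ENNReal.ofReal |x t i|) atTop = ⊤) : ¬ Stabilizes h G f := by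
  intro hst
  choose B hB using hst w z x u hcl
  have hle : limsup (fun t => ⨆ i, ENNReal.ofReal |x t i|) atTop ≤ ⨆ i, ENNReal.ofReal (B i) := by
    refine limsup_le_of_le (h := Eventually.of_forall fun t => iSup_mono fun i => ?_)
    refine ENNReal.ofReal_le_ofReal (le_trans ?_ (hB i ⟨t, rfl⟩))
    exact le_add_of_nonneg_right (abs_nonneg _)
  have hfin : ⨆ i, ENNReal.ofReal (B i) < ⊤ := by
    refine lt_of_le_of_lt (iSup_le fun i => ?_)
      (ENNReal.sum_lt_top.2 fun i _ => ENNReal.ofReal_lt_top : ∑ i, ENNReal.ofReal (B i) < ⊤)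
    exact Finset.single_le_sum (f := fun i => ENNReal.ofReal (B i)) (fun _ _ => zero_le)
      (Finset.mem_univ i)
  rw [hx] at hle
  exact absurd (lt_of_le_of_lt hle hfin) (lt_irrefl _)

end NetworkFeedback

open NetworkFeedback in
theorem theorem3 (L : ℝ) (hL : 0 < L) :
    -- one law works for all graphs (of any size) below the limit and all functions in the class
    (∃ h : LocalDecisionLaw, ∀ (n : ℕ) (G : InteractionGraph n), 0 < n →
      L * G.infNorm < 3 / 2 + Real.sqrt 2 → ∀ f ∈ functionClass L, Stabilizes h G f) ∧
    -- the limit is exact: for every value of the norm, a law exists if and only if `L` is below it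
    (∀ α : ℝ, 0 ≤ α →
      ((∃ h : LocalDecisionLaw, ∀ (n : ℕ) (G : InteractionGraph n), 0 < n →
          G.infNorm = α → ∀ f ∈ functionClass L, Stabilizes h G f) ↔
        L * α < 3 / 2 + Real.sqrt 2)) ∧
    -- at and above the limit every law fails, from every initial state
    (∀ α : ℝ, 3 / 2 + Real.sqrt 2 ≤ L * α → ∀ h : LocalDecisionLaw,
      ∃ (n : ℕ) (G : InteractionGraph n), 0 < n ∧ G.infNorm = α ∧
        ∀ x₀ : Fin n → ℝ, ∃ f ∈ functionClass L, ∃ w z x u : ℕ → Fin n → ℝ,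
          IsClosedLoop h G f w z x u ∧ x 0 = x₀ ∧
          Filter.limsup (fun t => ⨆ i, ENNReal.ofReal |x t i|) Filter.atTop = ⊤) := by
  have below : ∀ (n : ℕ) (G : InteractionGraph n), 0 < n →
      L * G.infNorm < 3 / 2 + Real.sqrt 2 → ∀ f ∈ functionClass L,
        Stabilizes nearestNeighborLaw G f :=
    fun n G hn hG f hf => nearestNeighborLaw_stabilizes hL G hn hG hf
  have above : ∀ α : ℝ, 3 / 2 + Real.sqrt 2 ≤ L * α → ∀ h : LocalDecisionLaw,
      ∃ (n : ℕ) (G : InteractionGraph n), 0 < n ∧ G.infNorm = α ∧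
        ∀ x₀ : Fin n → ℝ, ∃ f ∈ functionClass L, ∃ w z x u : ℕ → Fin n → ℝ,
          IsClosedLoop h G f w z x u ∧ x 0 = x₀ ∧
          Filter.limsup (fun t => ⨆ i, ENNReal.ofReal |x t i|) Filter.atTop = ⊤ := by
    intro α hα h
    have hα0 : 0 < α := by
      by_contra hneg
      have := mul_nonpos_of_nonneg_of_nonpos hL.le (not_lt.1 hneg)
      linarith [Real.sqrt_nonneg 2]
    exact ⟨1, InteractionGraph.selfLoop α hα0.ne', one_pos,
      InteractionGraph.infNorm_selfLoop α hα0, exists_unbounded_closedLoop hα0 hα h⟩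
  refine ⟨⟨nearestNeighborLaw, below⟩, fun α _ => ⟨?_, fun hα => ?_⟩, above⟩
  · rintro ⟨h, hh⟩
    by_contra hα
    obtain ⟨n, G, hn, hG, hx⟩ := above α (not_lt.1 hα) h
    obtain ⟨f, hf, w, z, x, u, hcl, -, hlim⟩ := hx 0
    exact not_stabilizes_of_limsup_eq_top hcl hlim (hh n G hn hG f hf)
  · exact ⟨nearestNeighborLaw, fun n G hn hG f hf => below n G hn (hG ▸ hα) f hf⟩
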